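/- For a topological space $X$, let $\mathscr{K}(X)$ denote the set of compact subsets of $X$ and give $\operatorname{Homeo}(X)$, the group of self-homeomorphisms of $X$, the compact-open topology. For $K\in\mathscr{K}(X)$ let $\operatorname{Homeo}_K(X)$ be the subgroup of those $h$ with $h(x)=x$ for all $x\in X\setminus K$, with the (subspace) compact-open topology, and put $\operatorname{Homeo}_{cpt}(X)=\bigcup_{K\in\mathscr{K}(X)}\operatorname{Homeo}_K(X)$. A Tychonoff space $X$ is said to have the Compactly Supported Homeomorphism Property (CSHP) if the following two topologies on $\operatorname{Homeo}_{cpt}(X)$ coincide: the finest topology making all inclusions $\operatorname{Homeo}_K(X)\to\operatorname{Homeo}_{cpt}(X)$, $K\in\mathscr{K}(X)$, continuous; and the topology induced by the embedding $h\mapsto\beta h$ into $\operatorname{Homeo}(\beta X)$ with the compact-open topology, where $\beta X$ is the Stone–Čech compactification of $X$ and $\beta h$ is the extension of $h$. For an infinite cardinal $\tau$, a subset $S$ of a space $X$ is $\tau$-discrete in $X$ if every subset of $S$ of cardinality less than $\tau$ is closed in $X$. The cofinality $\operatorname{cf}(\mathbb{I},\leq)$ of a partially ordered set is the smallest cardinality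 of a cofinal subset. **Theorem.** Let $Y$ be a compact Hausdorff space, let $Z$ be a zero-dimensional (i.e., having a base of clopen sets) locally compact Hausdorff pseudocompact (i.e., every continuous real-valued function on $Z$ is bounded) space that is not compact, and put $\tau=\operatorname{cf}(\mathscr{K}(Z),\subseteq)$. If $\operatorname{Homeo}(Y)$ contains a $\tau$-discrete subset of cardinality $\tau$ that is not closed in $\operatorname{Homeo}(Y)$, then the product $Y\times Z$ does not have CSHP. -/

import Mathlib

open Topology TopologicalSpace Cardinal

universe u v

/-- The compact-open topology on the homeomorphism group of `X`, i.e. the topology inherited from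
the space `C(X, X)` of continuous maps with its compact-open topology. -/
instance homeoCompactOpen (X : Type u) [TopologicalSpace X] : TopologicalSpace (X ≃ₜ X) :=
  TopologicalSpace.induced (fun h => (⟨h, h.continuous⟩ : C(X, X))) inferInstance

/-- A subset `S` of a space `X` is `τ`-discrete in `X` if every subset of `S` of cardinality less
than `τ` is closed in `X`. (The cardinal may live in another universe than `X`.) -/
def IsTauDiscrete {X : Type u} [TopologicalSpace X] (τ : Cardinal.{v}) (S : Set X) : Prop :=
  ∀ A : Set X, A ⊆ S → Cardinal.lift.{v} #A < Cardinal.lift.{u} τ → IsClosed A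

/-- Zero-dimensional: the clopen sets form a base of the topology. -/
def IsZeroDimensional (X : Type u) [TopologicalSpace X] : Prop :=
  IsTopologicalBasis {U : Set X | IsClopen U}

/-- Pseudocompact: every continuous real-valued function is bounded. -/
def IsPseudocompact (X : Type u) [TopologicalSpace X] : Prop :=
  ∀ f : X → ℝ, Continuous f → Bornology.IsBounded (Set.range f)

/-- The group of homeomorphisms of `X` supported in `K`, i.e. equal to the identity off `K`.
As a subtype of `X ≃ₜ X` it carries the compact-open topology. -/
def homeoSupportedIn {X : Type u} [TopologicalSpace X] (K : Set X) : Subgroup (X ≃ₜ X) where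
  carrier := {h | ∀ x, x ∉ K → h x = x}
  one_mem' := fun _ _ => rfl
  mul_mem' := by
    intro a b ha hb x hx
    change a (b x) = x
    rw [hb x hx, ha x hx]
  inv_mem' := by
    intro a ha x hx
    change a.symm x = x
    rw [Homeomorph.symm_apply_eq, ha x hx]

/-- The group of compactly supported homeomorphisms of `X`: the union of the groups
`homeoSupportedIn K` over all compact subsets `K` of `X`. -/
def homeoCpt (X : Type u) [TopologicalSpace X] : Subgroup (X ≃ₜ X) where
  carrier := {h | ∃ K : Compacts X, h ∈ homeoSupportedIn (K : Set X)}
  one_mem' := ⟨⊥, one_mem _⟩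
  mul_mem' := by
    rintro a b ⟨K, hK⟩ ⟨L, hL⟩
    refine ⟨K ⊔ L, mul_mem (fun x hx => hK x fun h => hx ?_) (fun x hx => hL x fun h => hx ?_)⟩
    · rw [Compacts.coe_sup]; exact Or.inl h
    · rw [Compacts.coe_sup]; exact Or.inr h
  inv_mem' := by
    rintro a ⟨K, hK⟩
    exact ⟨K, inv_mem hK⟩

/-- The inclusion of the homeomorphisms supported in the compact set `K` into the compactly
supported homeomorphisms. -/
def homeoInclusion {X : Type u} [TopologicalSpace X] (K : Compacts X) :
    homeoSupportedIn (K : Set X) → homeoCpt X :=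
  fun h => ⟨h.1, K, h.2⟩

/-- The colimit topology (in the category of topological spaces) on the group of compactly
supported homeomorphisms: the finest topology for which all inclusions `homeoInclusion K`
are continuous. (Mathlib orders topologies so that finer ones are smaller.) -/
@[reducible] def colimitTopology (X : Type u) [TopologicalSpace X] : TopologicalSpace (homeoCpt X) :=
  ⨆ K : Compacts X, TopologicalSpace.coinduced (homeoInclusion K) inferInstance

/-- The extension of a homeomorphism of `X` to the Stone–Čech compactification of `X`. -/
noncomputable def stoneCechHomeo {X : Type u} [TopologicalSpace X] (h : X ≃ₜ X) :
    StoneCech X ≃ₜ StoneCech X where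
  toFun := stoneCechExtend (continuous_stoneCechUnit.comp h.continuous)
  invFun := stoneCechExtend (continuous_stoneCechUnit.comp h.symm.continuous)
  left_inv := by
    refine congrFun (stoneCech_hom_ext
      ((continuous_stoneCechExtend _).comp (continuous_stoneCechExtend _)) continuous_id ?_)
    funext x
    simp [stoneCechExtend_stoneCechUnit]
  right_inv := by
    refine congrFun (stoneCech_hom_ext
      ((continuous_stoneCechExtend _).comp (continuous_stoneCechExtend _)) continuous_id ?_)
    funext x
    simp [stoneCechExtend_stoneCechUnit]
  continuous_toFun := continuous_stoneCechExtend _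
  continuous_invFun := continuous_stoneCechExtend _

/-- The topology on the group of compactly supported homeomorphisms of `X` induced by the
homeomorphism group (with the compact-open topology) of the Stone–Čech compactification. -/
@[reducible] noncomputable def stoneCechTopology (X : Type u) [TopologicalSpace X] : TopologicalSpace (homeoCpt X) :=
  TopologicalSpace.induced (fun h => stoneCechHomeo (h : X ≃ₜ X)) inferInstance

/-- The Compactly Supported Homeomorphism Property: the colimit topology and the topology induced
by the homeomorphism group of the Stone–Čech compactification coincide. -/
def CSHP (X : Type u) [TopologicalSpace X] : Prop :=
  colimitTopology X = stoneCechTopology X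

open Filter Set

/-! The set that separates the two topologies has the identity as a limit point. Translating `S` by
`g⁻¹`, for `g` in its closure but outside it, gives homeomorphisms `h i ≠ 1` of `Y`, indexed by the
initial ordinal of `τ`, that accumulate at 1 although every subfamily over a proper initial segment
is closed. Enumerate a cofinal family `K j` of compact sets and choose compact clopen `U i`
contained in no `K j` with `j ≤ i`. Let `F i` act as `h i` over `U i` and trivially elsewhere.

A compact set projecting into `K j` supports `F i` only for `i < j`, so `isClosed_range_sliceHomeo`
makes the range of `F` closed in the colimit topology. In the Stone–Čech topology 1 is a limit point
of it: by pseudocompactness a function on `Y × Z` has, up to `ε`, finitely many slices in `C(Y, ℝ)`,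
so `h i → 1` moves all slices uniformly little, whatever `U i` is
(`IsPseudocompact.eventually_dist_lt`, `tendsto_stoneCechHomeo_one`). -/

/-! ### The homeomorphism group with the compact-open topology -/

/-- A homeomorphism as a continuous self-map. -/
def homeoToMap {X : Type u} [TopologicalSpace X] (h : X ≃ₜ X) : C(X, X) := ⟨h, h.continuous⟩

lemma isInducing_homeoToMap (X : Type u) [TopologicalSpace X] :
    IsInducing (homeoToMap : (X ≃ₜ X) → C(X, X)) := ⟨rfl⟩

lemma injective_homeoToMap (X : Type u) [TopologicalSpace X] :
    Function.Injective (homeoToMap : (X ≃ₜ X) → C(X, X)) := fun _ _ h =>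
  Homeomorph.ext fun x => congrArg (fun k : C(X, X) => k x) h

instance homeo_t2Space (X : Type u) [TopologicalSpace X] [T2Space X] : T2Space (X ≃ₜ X) :=
  T2Space.of_injective_continuous (injective_homeoToMap X) (isInducing_homeoToMap X).continuous

lemma continuous_homeo_mul_left {X : Type u} [TopologicalSpace X] (g : X ≃ₜ X) :
    Continuous fun h : X ≃ₜ X => g * h :=
  (isInducing_homeoToMap X).continuous_iff.2 <|
    ((homeoToMap g).continuous_postcomp).comp (isInducing_homeoToMap X).continuous

/-! ### Pseudocompact and zero-dimensional spaces -/

/-- A continuous image of a pseudocompact space in a metric space is totally bounded. -/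
lemma IsPseudocompact.exists_finset_dist_lt {Z : Type v} [TopologicalSpace Z]
    (hZ : IsPseudocompact Z) {E : Type*} [MetricSpace E] {φ : Z → E} (hφ : Continuous φ)
    {ε : ℝ} (hε : 0 < ε) : ∃ t : Finset Z, ∀ z, ∃ w ∈ t, dist (φ z) (φ w) < ε := by
  by_contra! H
  let r : Z → Z → Prop := fun w z => ε ≤ dist (φ z) (φ w)
  have : Std.Symm r := ⟨fun a b h => by simpa only [r, dist_comm] using h⟩
  obtain ⟨z, -, hz⟩ := exists_seq_of_forall_finset_exists' (fun _ : Z => True) r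
    fun s _ => (H s).imp fun y hy => ⟨trivial, hy⟩
  -- An `ε`-separated sequence is a closed copy of `ℕ`; the Tietze extension of `n ↦ n` contradicts
  -- pseudocompactness.
  have he : IsClosedEmbedding fun n : ℕ => φ (z n) :=
    Metric.isClosedEmbedding_of_pairwise_le_dist hε fun m n hmn => hz hmn.symm
  obtain ⟨g, hg⟩ := ContinuousMap.exists_extension' he
    (⟨fun n : ℕ => (n : ℝ), continuous_of_discreteTopology⟩ : C(ℕ, ℝ))
  obtain ⟨C, hC⟩ := (hZ (g ∘ φ) (g.continuous.comp hφ)).exists_norm_le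
  obtain ⟨n, hn⟩ := exists_nat_gt C
  have h1 : g (φ (z n)) = n := congrFun hg n
  have h2 := hC _ ⟨z n, rfl⟩
  simp only [Function.comp_apply, h1, Real.norm_natCast] at h2
  exact absurd h2 (not_le.2 hn)

lemma IsZeroDimensional.exists_isClopen_isCompact_superset {Z : Type v} [TopologicalSpace Z]
    [LocallyCompactSpace Z] [T2Space Z] (hZ : IsZeroDimensional Z) {L : Set Z}
    (hL : IsCompact L) : ∃ U, IsClopen U ∧ IsCompact U ∧ L ⊆ U := by
  refine hL.induction_on (p := fun L => ∃ U, IsClopen U ∧ IsCompact U ∧ L ⊆ U)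
    ⟨∅, isClopen_empty, isCompact_empty, Subset.rfl⟩ ?_ ?_ ?_
  · rintro s t hst ⟨U, h1, h2, h3⟩
    exact ⟨U, h1, h2, hst.trans h3⟩
  · rintro s t ⟨U, h1, h2, h3⟩ ⟨V, k1, k2, k3⟩
    exact ⟨U ∪ V, h1.union k1, h2.union k2, union_subset_union h3 k3⟩
  · intro x _
    obtain ⟨M, hM, hxM⟩ := exists_compact_mem_nhds x
    obtain ⟨U, hU, hxU, hUM⟩ := hZ.mem_nhds_iff.1 hxM
    exact ⟨U, mem_nhdsWithin_of_mem_nhds (hU.isOpen.mem_nhds hxU), U, hU,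
      hM.of_isClosed_subset hU.isClosed hUM, Subset.rfl⟩

/-- If `h i` tends to the identity of the compact space `Y`, then each continuous function on
`Y × Z`, for `Z` pseudocompact, is eventually uniformly close to its composite with `h i × id`. -/
lemma IsPseudocompact.eventually_dist_lt {Y : Type u} {Z : Type v} [TopologicalSpace Y]
    [TopologicalSpace Z] [CompactSpace Y] (hZ : IsPseudocompact Z) (ψ : C(Y × Z, ℝ))
    {ι : Type*} {l : Filter ι} {h : ι → C(Y, Y)} (hh : Tendsto h l (𝓝 (ContinuousMap.id Y)))
    {ε : ℝ} (hε : 0 < ε) : ∀ᶠ i in l, ∀ y z, dist (ψ (h i y, z)) (ψ (y, z)) < ε := by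
  let φ : C(Z, C(Y, ℝ)) := (ψ.comp ⟨Prod.swap, continuous_swap⟩).curry
  have hφ : ∀ y z, φ z y = ψ (y, z) := fun _ _ => rfl
  obtain ⟨t, ht⟩ := hZ.exists_finset_dist_lt φ.continuous (ε := ε / 3) (by positivity)
  have h1 : ∀ w ∈ t, ∀ᶠ i in l, dist ((φ w).comp (h i)) (φ w) < ε / 3 := fun w _ =>
    (((φ w).continuous_postcomp.tendsto _).comp hh).eventually
      (Metric.ball_mem_nhds _ (by positivity))
  filter_upwards [(Finset.eventually_all t).2 h1] with i hi y z
  obtain ⟨w, hw, hzw⟩ := ht z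
  have a1 : dist (φ z (h i y)) (φ w (h i y)) < ε / 3 :=
    (ContinuousMap.dist_apply_le_dist _).trans_lt hzw
  have a2 : dist (φ w (h i y)) (φ w y) < ε / 3 :=
    (ContinuousMap.dist_apply_le_dist (f := (φ w).comp (h i)) (g := φ w) y).trans_lt (hi w hw)
  have a3 : dist (φ z y) (φ w y) < ε / 3 := (ContinuousMap.dist_apply_le_dist _).trans_lt hzw
  rw [← hφ, ← hφ]
  have := dist_triangle4 (φ z (h i y)) (φ w (h i y)) (φ w y) (φ z y)
  rw [dist_comm (φ w y) (φ z y)] at this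
  linarith

/-! ### Convergence in the topology of the Stone–Čech compactification -/

lemma stoneCechHomeo_unit {X : Type u} [TopologicalSpace X] (f : X ≃ₜ X) (x : X) :
    stoneCechHomeo f (stoneCechUnit x) = stoneCechUnit (f x) :=
  stoneCechExtend_stoneCechUnit (continuous_stoneCechUnit.comp f.continuous) x

/-- If all continuous real functions are eventually uniformly almost invariant under `f i`, then
the extensions of `f i` to the Stone–Čech compactification tend to the identity. -/
lemma tendsto_stoneCechHomeo_one {X : Type u} [TopologicalSpace X] {ι : Type*} {l : Filter ι}
    {f : ι → X ≃ₜ X}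
    (hf : ∀ (ψ : C(X, ℝ)) (ε : ℝ), 0 < ε → ∀ᶠ i in l, ∀ x, dist (ψ (f i x)) (ψ x) < ε) :
    Tendsto (fun i => stoneCechHomeo (f i)) l (𝓝 (stoneCechHomeo (1 : X ≃ₜ X))) := by
  rw [(isInducing_homeoToMap _).tendsto_nhds_iff, ContinuousMap.tendsto_nhds_compactOpen]
  intro K hK U hU hKU
  have hone : ∀ x : StoneCech X, stoneCechHomeo (1 : X ≃ₜ X) x = x := by
    refine congrFun (stoneCech_hom_ext (stoneCechHomeo (1 : X ≃ₜ X)).continuous continuous_id ?_)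
    funext x
    exact stoneCechHomeo_unit 1 x
  have hKU' : Disjoint K Uᶜ := disjoint_compl_right_iff_subset.2 fun x hx => by
    have := hKU hx
    rwa [show homeoToMap (stoneCechHomeo (1 : X ≃ₜ X)) x = x from hone x] at this
  obtain ⟨φ, hφK, hφU, -⟩ := exists_continuous_zero_one_of_isClosed hK.isClosed
    hU.isClosed_compl hKU'
  filter_upwards [hf (φ.comp ⟨stoneCechUnit, continuous_stoneCechUnit⟩) (1 / 2) (by norm_num)]
    with i hi x hx
  -- The bound passes from `X` to its compactification by density; a point of `K` sent outside `U`
  -- would change `φ` by 1.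
  have hcl : ∀ x, dist (φ (stoneCechHomeo (f i) x)) (φ x) ≤ 1 / 2 := by
    refine fun x => denseRange_stoneCechUnit.induction_on (p := fun x =>
      dist (φ (stoneCechHomeo (f i) x)) (φ x) ≤ 1 / 2) x ?_ fun x => ?_
    · have := (stoneCechHomeo (f i)).continuous
      exact isClosed_le (by fun_prop) continuous_const
    · rw [stoneCechHomeo_unit]
      exact (hi x).le
  by_contra hxU
  have h1 : φ (stoneCechHomeo (f i) x) = 1 := hφU hxU
  have h2 : φ x = 0 := hφK hx
  have := hcl x
  rw [h1, h2] at this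
  norm_num at this

/-! ### Homeomorphisms of a product acting on the slices over a clopen set -/

section Slice

variable {Y : Type u} {Z : Type v} [TopologicalSpace Y] [TopologicalSpace Z]

open Classical in
/-- The homeomorphism of `Y × Z` acting as `h` on the slices over the clopen set `U` and as the
identity on the other slices. -/
noncomputable def sliceHomeo (h : Y ≃ₜ Y) {U : Set Z} (hU : IsClopen U) : Y × Z ≃ₜ Y × Z where
  toFun p := (if p.2 ∈ U then h p.1 else p.1, p.2)
  invFun p := (if p.2 ∈ U then h.symm p.1 else p.1, p.2)
  left_inv p := by by_cases hp : p.2 ∈ U <;> simp [hp]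
  right_inv p := by by_cases hp : p.2 ∈ U <;> simp [hp]
  continuous_toFun := by
    refine .prodMk (continuous_if ?_ ?_ ?_) continuous_snd
    · intro p hp
      rw [show {a : Y × Z | a.2 ∈ U} = Prod.snd ⁻¹' U from rfl,
        (hU.preimage continuous_snd).frontier_eq] at hp
      exact hp.elim
    · exact (h.continuous.comp continuous_fst).continuousOn
    · exact continuous_fst.continuousOn
  continuous_invFun := by
    refine .prodMk (continuous_if ?_ ?_ ?_) continuous_snd
    · intro p hp
      rw [show {a : Y × Z | a.2 ∈ U} = Prod.snd ⁻¹' U from rfl,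
        (hU.preimage continuous_snd).frontier_eq] at hp
      exact hp.elim
    · exact (h.symm.continuous.comp continuous_fst).continuousOn
    · exact continuous_fst.continuousOn

lemma sliceHomeo_apply_of_mem (h : Y ≃ₜ Y) {U : Set Z} (hU : IsClopen U) (y : Y) {z : Z}
    (hz : z ∈ U) : sliceHomeo h hU (y, z) = (h y, z) := by
  simp [sliceHomeo, hz]

lemma sliceHomeo_apply_of_notMem (h : Y ≃ₜ Y) {U : Set Z} (hU : IsClopen U) (y : Y) {z : Z}
    (hz : z ∉ U) : sliceHomeo h hU (y, z) = (y, z) := by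
  simp [sliceHomeo, hz]

lemma sliceHomeo_apply_snd (h : Y ≃ₜ Y) {U : Set Z} (hU : IsClopen U) (p : Y × Z) :
    (sliceHomeo h hU p).2 = p.2 := rfl

lemma sliceHomeo_mem_homeoCpt [CompactSpace Y] (h : Y ≃ₜ Y) {U : Set Z} (hU : IsClopen U)
    (hUc : IsCompact U) : sliceHomeo h hU ∈ homeoCpt (Y × Z) :=
  ⟨⟨Set.univ ×ˢ U, isCompact_univ.prod hUc⟩, fun p hp =>
    sliceHomeo_apply_of_notMem h hU p.1 fun hz => hp ⟨mem_univ _, hz⟩⟩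

/-- The family of the maps induced on the factor `Y` by a self-map of `Y × Z`. -/
def sliceMap (f : C(Y × Z, Y × Z)) : C(Z, C(Y, Y)) :=
  ((ContinuousMap.fst.comp f).comp ⟨Prod.swap, continuous_swap⟩).curry

lemma sliceMap_apply (f : C(Y × Z, Y × Z)) (y : Y) (z : Z) : sliceMap f z y = (f (y, z)).1 := rfl

/-- This allows limits to be controlled uniformly over compact sets of slices, not only slice by
slice. -/
lemma continuous_sliceMap [LocallyCompactSpace Y] [LocallyCompactSpace Z] :
    Continuous (sliceMap : C(Y × Z, Y × Z) → C(Z, C(Y, Y))) :=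
  ContinuousMap.continuous_curry.comp <|
    (ContinuousMap.continuous_precomp _).comp (ContinuousMap.continuous_postcomp _)

lemma sliceMap_sliceHomeo_of_mem (h : Y ≃ₜ Y) {U : Set Z} (hU : IsClopen U) {z : Z}
    (hz : z ∈ U) : sliceMap (homeoToMap (sliceHomeo h hU)) z = homeoToMap h := by
  ext y
  exact congrArg Prod.fst (sliceHomeo_apply_of_mem h hU y hz)

lemma sliceMap_sliceHomeo_of_notMem (h : Y ≃ₜ Y) {U : Set Z} (hU : IsClopen U) {z : Z}
    (hz : z ∉ U) : sliceMap (homeoToMap (sliceHomeo h hU)) z = ContinuousMap.id Y := by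
  ext y
  exact congrArg Prod.fst (sliceHomeo_apply_of_notMem h hU y hz)

/-- A homeomorphism of `Y × Z` over `Z` restricts to homeomorphisms of the slices. -/
lemma exists_homeoToMap_eq_sliceMap {f : Y × Z ≃ₜ Y × Z} (hf : ∀ p, (f p).2 = p.2) (z : Z) :
    ∃ k : Y ≃ₜ Y, homeoToMap k = sliceMap (homeoToMap f) z := by
  have hf' : ∀ p, (f.symm p).2 = p.2 := fun p => by
    simpa using (hf (f.symm p)).symm
  refine ⟨{ toFun := fun y => (f (y, z)).1
            invFun := fun y => (f.symm (y, z)).1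
            left_inv := fun y => ?_
            right_inv := fun y => ?_
            continuous_toFun := by
              have := f.continuous
              fun_prop
            continuous_invFun := by
              have := f.symm.continuous
              fun_prop }, rfl⟩
  · have : ((f (y, z)).1, z) = f (y, z) := Prod.ext rfl (hf (y, z)).symm
    simp [this]
  · have : ((f.symm (y, z)).1, z) = f.symm (y, z) := Prod.ext rfl (hf' (y, z)).symm
    simp [this]

/-- If every subfamily of the injective family `h` in `Homeo(Y)` is closed and misses the identity,
then the homeomorphisms acting as `h i` over nonempty clopen subsets `U i` of a fixed compact set
form a closed set. -/
lemma isClosed_range_sliceHomeo [CompactSpace Y] [T2Space Y] [LocallyCompactSpace Z] [T2Space Z]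
    {ι : Type*} {h : ι → Y ≃ₜ Y} (hinj : Function.Injective h) (hne : ∀ i, h i ≠ 1)
    (hclosed : ∀ B : Set ι, IsClosed (h '' B)) {U : ι → Set Z} (hU : ∀ i, IsClopen (U i))
    (hUne : ∀ i, (U i).Nonempty) {K : Set Z} (hK : IsCompact K) (hUK : ∀ i, U i ⊆ K) :
    IsClosed (range fun i => sliceHomeo (h i) (hU i)) := by
  have hR : Continuous fun f : Y × Z ≃ₜ Y × Z => sliceMap (homeoToMap f) :=
    continuous_sliceMap.comp (isInducing_homeoToMap _).continuous
  have hRz : ∀ z, Continuous fun f : Y × Z ≃ₜ Y × Z => sliceMap (homeoToMap f) z :=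
    fun z => (continuous_eval_const z).comp hR
  refine isClosed_of_closure_subset fun f hf => ?_
  -- Being fibred over `Z` is a closed condition. It makes the slices of the limit `f`
  -- homeomorphisms, and the family `h` is closed only within `Homeo(Y)`.
  have hfib : ∀ p, (f p).2 = p.2 := by
    intro p
    have hc : IsClosed {g : Y × Z ≃ₜ Y × Z | (g p).2 = p.2} :=
      isClosed_eq (continuous_snd.comp ((continuous_eval_const (F := C(Y × Z, Y × Z)) p).comp
        (isInducing_homeoToMap (Y × Z)).continuous)) continuous_const
    refine closure_minimal (t := {g : Y × Z ≃ₜ Y × Z | (g p).2 = p.2}) ?_ hc hf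
    exact range_subset_iff.2 fun i => sliceHomeo_apply_snd _ _ p
  by_cases hid : ∀ z, sliceMap (homeoToMap f) z = ContinuousMap.id Y
  · obtain ⟨D, hD, hDh⟩ := (isInducing_homeoToMap Y).isClosed_iff.1 (hclosed Set.univ)
    have h1 : ContinuousMap.id Y ∉ D := fun hmem => by
      have : (1 : Y ≃ₜ Y) ∈ homeoToMap ⁻¹' D := hmem
      rw [hDh] at this
      obtain ⟨i, -, hi⟩ := this
      exact hne i hi
    -- Near `f` all slices over the compact set `K` avoid the closed family at once, yet each member
    -- of the range has a slice `h i` over a point of `K`.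
    have hopen := (ContinuousMap.isOpen_setOfPred_mapsTo hK hD.isOpen_compl).preimage hR
    obtain ⟨_, hg, i, rfl⟩ := mem_closure_iff.1 hf _ hopen fun z _ => by rwa [hid z]
    obtain ⟨z, hz⟩ := hUne i
    have h2 := hg (hUK i hz)
    rw [sliceMap_sliceHomeo_of_mem _ _ hz] at h2
    refine (h2 ?_).elim
    change h i ∈ homeoToMap ⁻¹' D
    rw [hDh]
    exact mem_image_of_mem h (mem_univ i)
  · push Not at hid
    obtain ⟨z, hz⟩ := hid
    obtain ⟨k, hk⟩ := exists_homeoToMap_eq_sliceMap hfib z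
    obtain ⟨D, hD, hDh⟩ := (isInducing_homeoToMap Y).isClosed_iff.1 (hclosed {i | h i ≠ k})
    have hkD : homeoToMap k ∉ D := fun hmem => by
      have : k ∈ homeoToMap ⁻¹' D := hmem
      rw [hDh] at this
      obtain ⟨i, hi, hik⟩ := this
      exact hi hik
    -- Membership in `V` excludes the identity slice, forcing `z ∈ U i`, and then every `h i ≠ k`.
    -- By injectivity at most one member of the range lies in `V`, so `f` equals it.
    set V : Set (Y × Z ≃ₜ Y × Z) :=
      {g | sliceMap (homeoToMap g) z ∈ Dᶜ ∩ {ContinuousMap.id Y}ᶜ} with hV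
    have hVo : IsOpen V := (hD.isOpen_compl.inter isOpen_compl_singleton).preimage (hRz z)
    have hfV : f ∈ V := ⟨by rwa [← hk], hz⟩
    have key : ∀ i, sliceHomeo (h i) (hU i) ∈ V → h i = k := by
      intro i hi
      have hzU : z ∈ U i := by
        by_contra hzU
        exact hi.2 (sliceMap_sliceHomeo_of_notMem _ _ hzU)
      have h3 := hi.1
      rw [sliceMap_sliceHomeo_of_mem _ _ hzU] at h3
      by_contra hik
      refine h3 ?_
      change h i ∈ homeoToMap ⁻¹' D
      rw [hDh]
      exact mem_image_of_mem h hik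
    obtain ⟨_, hgV, i, rfl⟩ := mem_closure_iff.1 hf V hVo hfV
    refine ⟨i, ?_⟩
    by_contra hne'
    obtain ⟨_, ⟨hjV, hji⟩, j, rfl⟩ := mem_closure_iff.1 hf
      (V ∩ {sliceHomeo (h i) (hU i)}ᶜ) (hVo.inter isOpen_compl_singleton)
      ⟨hfV, fun h => hne' (mem_singleton_iff.1 h).symm⟩
    have hij : j = i := hinj ((key j hjV).trans (key i hgV).symm)
    subst hij
    exact hji rfl

end Slice

/-! ### Cofinal families of compact sets -/

/-- In a preorder of infinite cofinality `τ` there are a cofinal family and a family none of whose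
members lies below an earlier member of the cofinal family. -/
lemma exists_cofinal_family_not_le {P : Type v} [Preorder P] (hτ : ℵ₀ ≤ Order.cof P) :
    ∃ (I : Type v) (_ : LinearOrder I) (K L : I → P),
      #I = Order.cof P ∧ (∀ i : I, #(Iio i) < Order.cof P) ∧
      (∀ p, ∃ i, p ≤ K i) ∧ ∀ i j, j ≤ i → ¬ L i ≤ K j := by
  obtain ⟨s, hs, hcard⟩ := Order.exists_cof_eq P
  obtain ⟨e⟩ := Cardinal.eq.1 ((Cardinal.mk_ord_toType (Order.cof P)).trans hcard.symm)
  have hIio : ∀ i : (Order.cof P).ord.ToType, #(Iio i) < Order.cof P := fun i => by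
    simpa using Cardinal.mk_Iio_lt i (by simp)
  -- Otherwise the members up to `i` would already be cofinal, and there are fewer than `τ` of them
  -- since `τ` is infinite.
  have hL : ∀ i, ∃ L : P, ∀ j ≤ i, ¬ L ≤ (e j : P) := by
    intro i
    by_contra! H
    have hcof : IsCofinal ((fun j => (e j : P)) '' Iic i) := fun p => by
      obtain ⟨j, hj, hpj⟩ := H p
      exact ⟨_, mem_image_of_mem _ hj, hpj⟩
    refine (Order.cof_le hcof).not_gt (Cardinal.mk_image_le.trans_lt ?_)
    rw [← Iio_insert]
    refine (Cardinal.mk_insert_le).trans_lt ?_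
    exact Cardinal.add_lt_of_lt hτ (hIio i)
      (Cardinal.one_lt_aleph0.trans_le hτ)
  choose L hL using hL
  refine ⟨_, inferInstance, fun i => e i, L, Cardinal.mk_ord_toType _, hIio, fun p => ?_, fun i j hj => hL i j hj⟩
  obtain ⟨q, hq, hpq⟩ := hs p
  exact ⟨e.symm ⟨q, hq⟩, by simpa using hpq⟩

/-! ### The range of `F` in the two topologies -/

theorem theoremB {Y : Type u} {Z : Type v} [TopologicalSpace Y] [TopologicalSpace Z]
    [CompactSpace Y] [T2Space Y]
    [LocallyCompactSpace Z] [T2Space Z]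
    (hZ₀ : IsZeroDimensional Z) (hZp : IsPseudocompact Z) (hZc : ¬ CompactSpace Z)
    (hY : ∃ S : Set (Y ≃ₜ Y),
      IsTauDiscrete (Order.cof (Compacts Z)) S ∧
      Cardinal.lift.{v} #S = Cardinal.lift.{u} (Order.cof (Compacts Z)) ∧
      ¬ IsClosed S) :
    ¬ CSHP (Y × Z) := by
  obtain ⟨S, hSd, hScard, hSc⟩ := hY
  -- For finite `τ` the set `S` would be finite, hence closed.
  have hτ : ℵ₀ ≤ Order.cof (Compacts Z) := by
    by_contra! hlt
    refine hSc (Set.Finite.isClosed ?_)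
    rw [← Cardinal.lt_aleph0_iff_set_finite, ← Cardinal.lift_lt_aleph0.{u, v}, hScard]
    exact Cardinal.lift_lt_aleph0.2 hlt
  obtain ⟨I, _, K, L, hI, hIio, hKcof, hLK⟩ := exists_cofinal_family_not_le hτ
  obtain ⟨e⟩ : Nonempty (I ≃ S) := by
    rw [← Cardinal.lift_mk_eq'.{v, u}, hI, hScard]
  obtain ⟨g, hgcl, hgS⟩ : ∃ g ∈ closure S, g ∉ S := by
    by_contra! H
    exact hSc (isClosed_of_closure_subset H)
  choose U hU hUc hLU using fun i =>
    hZ₀.exists_isClopen_isCompact_superset (L i).isCompact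
  have hUK : ∀ i j, U i ⊆ K j → i < j := fun i j hij =>
    lt_of_not_ge fun hji => hLK i j hji ((hLU i).trans hij)
  have hUne : ∀ i, (U i).Nonempty := fun i =>
    nonempty_iff_ne_empty.2 fun h0 => (hUK i i (by simp [h0])).false
  let h : I → Y ≃ₜ Y := fun i => g⁻¹ * e i
  have hinj : Function.Injective h := fun i j hij =>
    e.injective (Subtype.ext (mul_left_cancel hij))
  have hne : ∀ i, h i ≠ 1 := fun i hi => hgS <| by
    rw [show g = e i from (inv_mul_eq_one.1 hi)]
    exact (e i).2
  have hclosed : ∀ (j : I) (B : Set I), B ⊆ Iio j → IsClosed (h '' B) := by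
    intro j B hB
    have h1 : IsClosed ((fun i => (e i : Y ≃ₜ Y)) '' B) := by
      refine hSd _ (image_subset_iff.2 fun i _ => (e i).2) ?_
      refine Cardinal.mk_image_le_lift.trans_lt (Cardinal.lift_lt.2 ?_)
      exact (Cardinal.mk_le_mk_of_subset hB).trans_lt (hIio j)
    convert h1.preimage (continuous_homeo_mul_left g) using 1
    ext k
    simp only [mem_image, mem_preimage, h]
    exact exists_congr fun i => and_congr_right fun _ => inv_mul_eq_iff_eq_mul
  let F : I → homeoCpt (Y × Z) := fun i =>
    ⟨sliceHomeo (h i) (hU i), sliceHomeo_mem_homeoCpt _ _ (hUc i)⟩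
  have hFne : ∀ i, F i ≠ 1 := by
    intro i hi
    obtain ⟨z, hz⟩ := hUne i
    refine hne i (Homeomorph.ext fun y => ?_)
    have h1 : sliceHomeo (h i) (hU i) = 1 := congrArg Subtype.val hi
    have h2 := sliceHomeo_apply_of_mem (h i) (hU i) y hz
    rw [h1] at h2
    exact (congrArg Prod.fst h2).symm
  have hFclosed : IsClosed[colimitTopology (Y × Z)] (range F) := by
    refine isClosed_iSup_iff.2 fun C => isClosed_coinduced.2 ?_
    -- Only indices below this `j` matter for `C`: as `h i` moves some point, a support inside `C`
    -- forces `U i ⊆ K j`.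
    obtain ⟨j, hj⟩ := hKcof (C.map Prod.snd continuous_snd)
    let A : Set I := {i | sliceHomeo (h i) (hU i) ∈ homeoSupportedIn (C : Set (Y × Z))}
    have hA : ∀ i ∈ A, U i ⊆ K j := by
      intro i hi z hz
      obtain ⟨y, hy⟩ : ∃ y, h i y ≠ y := by
        by_contra! H
        exact hne i (Homeomorph.ext H)
      refine hj ⟨(y, z), ?_, rfl⟩
      by_contra hC
      have := hi (y, z) hC
      rw [sliceHomeo_apply_of_mem _ _ _ hz] at this
      exact hy (congrArg Prod.fst this)
    have hcl := isClosed_range_sliceHomeo (ι := A) (h := fun i => h i)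
      (fun a b hab => Subtype.ext (hinj hab)) (fun i => hne i)
      (fun B => by
        have := hclosed j (Subtype.val '' B) (by
          rintro _ ⟨i, -, rfl⟩
          exact hUK _ _ (hA i i.2))
        rwa [image_image] at this)
      (fun i => hU i) (fun i => hUne i) (K j).isCompact (fun i => hA i i.2)
    convert hcl.preimage (continuous_subtype_val (p := (· ∈ homeoSupportedIn (C : Set (Y × Z)))))
      using 1
    ext k
    constructor
    · rintro ⟨i, hi⟩
      have hik : sliceHomeo (h i) (hU i) = k := congrArg Subtype.val hi
      exact ⟨⟨i, show sliceHomeo (h i) (hU i) ∈ _ from hik ▸ k.2⟩, hik⟩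
    · rintro ⟨i, hi⟩
      exact ⟨i, Subtype.ext hi⟩
  intro hCSHP
  rw [hCSHP] at hFclosed
  -- Convergence is taken along the filter of `h i → 1`, not along the order of `I`; it is proper
  -- because `g ∈ closure S`.
  let l : Filter I := comap h (𝓝 1)
  have : l.NeBot := by
    refine comap_neBot_iff.2 fun t ht => ?_
    have ht' : (fun k => g⁻¹ * k) ⁻¹' t ∈ 𝓝 g :=
      (continuous_homeo_mul_left g⁻¹).continuousAt (by simpa using ht)
    obtain ⟨k, hkt, hkS⟩ := mem_closure_iff_nhds.1 hgcl _ ht'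
    exact ⟨e.symm ⟨k, hkS⟩, by simpa [h] using hkt⟩
  have hl : Tendsto (fun i => homeoToMap (h i)) l (𝓝 (ContinuousMap.id Y)) :=
    ((isInducing_homeoToMap Y).continuous.tendsto 1).comp tendsto_comap
  have hlim : Tendsto (fun i => stoneCechHomeo (sliceHomeo (h i) (hU i))) l
      (𝓝 (stoneCechHomeo (1 : Y × Z ≃ₜ Y × Z))) := by
    refine tendsto_stoneCechHomeo_one fun ψ ε hε => ?_
    filter_upwards [hZp.eventually_dist_lt ψ hl hε] with i hi
    rintro ⟨y, z⟩
    by_cases hz : z ∈ U i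
    · rw [sliceHomeo_apply_of_mem _ _ _ hz]
      exact hi y z
    · rwa [sliceHomeo_apply_of_notMem _ _ _ hz, dist_self]
  let _ : TopologicalSpace (homeoCpt (Y × Z)) := stoneCechTopology (Y × Z)
  have hlimF : Tendsto F l (𝓝 1) :=
    (IsInducing.mk (f := fun k : homeoCpt (Y × Z) => stoneCechHomeo (k : Y × Z ≃ₜ Y × Z))
      rfl).tendsto_nhds_iff.2 hlim
  obtain ⟨i, hi⟩ := hFclosed.mem_of_tendsto hlimF (Eventually.of_forall mem_range_self)
  exact hFne i hi
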